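/- Let $I=(a,b)$ be a bounded open interval, $a<b$. For $u\in L^1(I)$ let $$J(u)=\sup\Big\{\int_a^b u(x)\,\xi'(x)\,dx \;:\; \xi\in C^1_0(I),\ \|\xi\|_\infty\le 1\Big\}\in[0,\infty]$$ be its total variation, where $C_0^1(I)$ denotes the continuously differentiable functions with compact support in $I$, and let $BV(I)=\{u\in L^1(I): J(u)<\infty\}$. Let $f$ be piecewise constant on $I$, i.e. there is a finite partition $a=x_0<x_1<\dots<x_n=b$ such that $f$ is constant on each open interval $(x_{i},x_{i+1})$. Then for every $\lambda>0$ the Rudin–Osher–Fatemi functional $$E_\lambda(u)=\lambda J(u)+\tfrac12\|f-u\|_{L^2(I)}^2,\qquad u\in BV(I),$$ has a minimizer $u_\lambda$ over $BV(I)$, unique up to equality almost everywhere; moreover $f-u_\lambda\in L^2(I)$, and $$\|f-u_\lambda\|_{L^2(I)}=O(\lambda)\qquad\text{as }\lambda\to 0+ .$$ -/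

import Mathlib

open MeasureTheory Filter Topology Asymptotics
open scoped ENNReal

namespace ROF

/-- Lebesgue measure on the open interval `I = (a, b)`. -/
noncomputable def vol (a b : ℝ) : Measure ℝ := volume.restrict (Set.Ioo a b)

/-- The test functions for the total variation: `ξ ∈ C₀¹(I)` (continuously differentiable with
compact support contained in the open interval `I = (a, b)`) such that `‖ξ‖_∞ ≤ 1`. -/
def IsTest (a b : ℝ) (ξ : ℝ → ℝ) : Prop :=
  ContDiff ℝ 1 ξ ∧ HasCompactSupport ξ ∧ tsupport ξ ⊆ Set.Ioo a b ∧ ∀ x, |ξ x| ≤ 1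

/-- The total variation `J(u) = sup { ∫_a^b u ξ' dx : ξ ∈ C₀¹(I), ‖ξ‖_∞ ≤ 1 } ∈ [0, ∞]` of an
integrable function on `(a, b)`. Since `ξ = 0` is admissible the supremum is nonnegative, so
replacing negative integrals by `0` through `ENNReal.ofReal` does not change it. -/
noncomputable def totalVariation (a b : ℝ) (u : ℝ → ℝ) : ℝ≥0∞ :=
  ⨆ (ξ : ℝ → ℝ) (_ : IsTest a b ξ), ENNReal.ofReal (∫ x, u x * deriv ξ x ∂(vol a b))

/-- `u ∈ BV(I)`: `u` is integrable on `(a, b)` and has finite total variation. -/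
def MemBV (a b : ℝ) (u : ℝ → ℝ) : Prop :=
  Integrable u (vol a b) ∧ totalVariation a b u < ∞

/-- The ROF functional `E_λ(u) = λ J(u) + ½ ‖f - u‖²_{L²(I)}`, with values in `[0, ∞]`. -/
noncomputable def energy (a b : ℝ) (f : ℝ → ℝ) (lam : ℝ) (u : ℝ → ℝ) : ℝ≥0∞ :=
  ENNReal.ofReal lam * totalVariation a b u + 2⁻¹ * eLpNorm (f - u) 2 (vol a b) ^ 2

/-- `u` minimizes the ROF functional `E_λ` over `BV(I)`. -/
def IsMinimizer (a b : ℝ) (f : ℝ → ℝ) (lam : ℝ) (u : ℝ → ℝ) : Prop :=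
  MemBV a b u ∧ ∀ v, MemBV a b v → energy a b f lam u ≤ energy a b f lam v

/-- `f` is piecewise constant on `(a, b)`: there is a finite partition `a = x₀ < ⋯ < xₙ = b` such
that `f` is constant on each open interval `(xᵢ, xᵢ₊₁)`. -/
def IsPiecewiseConstant (a b : ℝ) (f : ℝ → ℝ) : Prop :=
  ∃ (n : ℕ) (x : Fin (n + 1) → ℝ), StrictMono x ∧ x 0 = a ∧ x (Fin.last n) = b ∧
    ∀ i : Fin n, ∃ c : ℝ, ∀ t ∈ Set.Ioo (x i.castSucc) (x i.succ), f t = c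

end ROF

namespace ROF

open Set

/-! ### Elementary properties of the total variation and of the energy -/

/-! The problem reduces to finite dimensions. Let `P u` be the step function of the means of `u`
over the pieces of the partition of `f`. Then `P` does not increase the energy. For the fidelity
term this is nonnegativity of the variance on each piece (`eLpNorm_step_sub_step_mean_le`). For the
total variation, `∫ (P u) ξ' = ∫ u (Q ξ)'` with `Q ξ` the piecewise linear interpolant of `ξ` at the
nodes, and `|Q ξ| ≤ 1`; since `Q ξ` is not `C¹`, its derivative is smoothed and a limit taken
(`totalVariation_step_mean_le`).

A minimizer over the coefficients, which exists by continuity and coercivity, is therefore a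
minimizer over `BV`. Uniqueness is strict convexity of the squared norm. For the rate, let `N` be
the `L²` distance from the datum `d` to the minimizer `c`. Comparison with `d` gives `N² ≤ 2 λ (J d
- J c)`, and `J` is Lipschitz on the step functions of a fixed partition, so `N² ≤ 2 λ C N`
(`sqrt_sum_le_of_isMinimizer`). -/

instance (a b : ℝ) : IsFiniteMeasure (vol a b) := by
  unfold vol; infer_instance

lemma IsTest.continuous_deriv {a b : ℝ} {ξ : ℝ → ℝ} (h : IsTest a b ξ) :
    Continuous (deriv ξ) := h.1.continuous_deriv le_rfl

lemma IsTest.exists_bound_deriv {a b : ℝ} {ξ : ℝ → ℝ} (h : IsTest a b ξ) :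
    ∃ C, ∀ t, ‖deriv ξ t‖ ≤ C := h.2.1.deriv.exists_bound_of_continuous h.continuous_deriv

lemma IsTest.integrable_mul_deriv {a b : ℝ} {ξ u : ℝ → ℝ} (h : IsTest a b ξ)
    (hu : Integrable u (vol a b)) : Integrable (fun t => u t * deriv ξ t) (vol a b) := by
  obtain ⟨C, hC⟩ := h.exists_bound_deriv
  exact hu.mul_bdd h.continuous_deriv.aestronglyMeasurable (ae_of_all _ hC)

lemma IsTest.apply_eq_zero {a b : ℝ} {ξ : ℝ → ℝ} (h : IsTest a b ξ) {t : ℝ}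
    (ht : t ∉ Ioo a b) : ξ t = 0 :=
  image_eq_zero_of_notMem_tsupport fun h' => ht (h.2.2.1 h')

lemma IsTest.le_totalVariation {a b : ℝ} {ξ : ℝ → ℝ} (h : IsTest a b ξ) (u : ℝ → ℝ) :
    ENNReal.ofReal (∫ t, u t * deriv ξ t ∂(vol a b)) ≤ totalVariation a b u :=
  le_iSup₂ (f := fun (ξ : ℝ → ℝ) (_ : IsTest a b ξ) =>
    ENNReal.ofReal (∫ x, u x * deriv ξ x ∂(vol a b))) ξ h

lemma totalVariation_le {a b : ℝ} {u : ℝ → ℝ} {M : ℝ≥0∞}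
    (h : ∀ ξ, IsTest a b ξ → ENNReal.ofReal (∫ t, u t * deriv ξ t ∂(vol a b)) ≤ M) :
    totalVariation a b u ≤ M := iSup₂_le h

lemma totalVariation_congr {a b : ℝ} {u v : ℝ → ℝ} (h : u =ᵐ[vol a b] v) :
    totalVariation a b u = totalVariation a b v := by
  unfold totalVariation
  refine iSup_congr fun ξ => iSup_congr fun _ => ?_
  congr 1
  refine integral_congr_ae ?_
  filter_upwards [h] with t ht
  rw [ht]

lemma totalVariation_add_le {a b : ℝ} {u v : ℝ → ℝ} (hu : Integrable u (vol a b))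
    (hv : Integrable v (vol a b)) :
    totalVariation a b (u + v) ≤ totalVariation a b u + totalVariation a b v := by
  refine totalVariation_le fun ξ hξ => ?_
  have : ∫ t, (u + v) t * deriv ξ t ∂(vol a b)
      = ∫ t, u t * deriv ξ t ∂(vol a b) + ∫ t, v t * deriv ξ t ∂(vol a b) := by
    rw [← integral_add (hξ.integrable_mul_deriv hu) (hξ.integrable_mul_deriv hv)]
    simp [add_mul]
  rw [this]
  exact ENNReal.ofReal_add_le.trans
    (add_le_add (hξ.le_totalVariation u) (hξ.le_totalVariation v))

lemma totalVariation_const_mul_le {a b : ℝ} (u : ℝ → ℝ) {r : ℝ} (hr : 0 ≤ r) :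
    totalVariation a b (fun t => r * u t) ≤ ENNReal.ofReal r * totalVariation a b u := by
  refine totalVariation_le fun ξ hξ => ?_
  simp_rw [mul_assoc, integral_const_mul]
  rw [ENNReal.ofReal_mul hr]
  gcongr
  exact hξ.le_totalVariation u

lemma energy_congr {a b : ℝ} {f g u v : ℝ → ℝ} (lam : ℝ) (hfg : f =ᵐ[vol a b] g)
    (huv : u =ᵐ[vol a b] v) : energy a b f lam u = energy a b g lam v := by
  unfold energy
  rw [totalVariation_congr huv, eLpNorm_congr_ae (hfg.sub huv)]

lemma isMinimizer_congr {a b : ℝ} {f g : ℝ → ℝ} {lam : ℝ} (hfg : f =ᵐ[vol a b] g) (u : ℝ → ℝ) :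
    IsMinimizer a b f lam u ↔ IsMinimizer a b g lam u := by
  unfold IsMinimizer
  simp_rw [energy_congr lam hfg (EventuallyEq.refl _ _)]

lemma eLpNorm_two_sq {μ : Measure ℝ} {g : ℝ → ℝ} (hg : MemLp g 2 μ) :
    eLpNorm g 2 μ ^ 2 = ENNReal.ofReal (∫ t, g t ^ 2 ∂μ) := by
  rw [hg.eLpNorm_eq_integral_rpow_norm (by simp) (by simp), ← ENNReal.ofReal_pow (by positivity)]
  congr 1
  have h0 : 0 ≤ ∫ t, g t ^ 2 ∂μ := integral_nonneg fun t => sq_nonneg _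
  simp only [ENNReal.toReal_ofNat, Real.rpow_two, Real.norm_eq_abs, sq_abs]
  rw [← Real.rpow_natCast, ← Real.rpow_mul h0]
  norm_num

/-- On functions of finite energy the energy is a real number. -/
lemma energy_eq_ofReal {a b : ℝ} {f u : ℝ → ℝ} {lam : ℝ} (hlam : 0 ≤ lam)
    (hJ : totalVariation a b u < ∞) (hfu : MemLp (f - u) 2 (vol a b)) :
    energy a b f lam u = ENNReal.ofReal
      (lam * (totalVariation a b u).toReal + 2⁻¹ * ∫ t, (f t - u t) ^ 2 ∂(vol a b)) := by
  have h0 : 0 ≤ ∫ t, (f t - u t) ^ 2 ∂(vol a b) := integral_nonneg fun t => sq_nonneg _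
  unfold energy
  rw [eLpNorm_two_sq hfu, ENNReal.ofReal_add (by positivity) (by positivity),
    ENNReal.ofReal_mul hlam, ENNReal.ofReal_toReal hJ.ne, ENNReal.ofReal_mul (by norm_num),
    ENNReal.ofReal_inv_of_pos (by norm_num)]
  simp

/-- Two minimizers of finite energy coincide almost everywhere. -/
lemma ae_eq_of_isMinimizer {a b : ℝ} {f u v : ℝ → ℝ} {lam : ℝ} (hlam : 0 < lam)
    (hu : IsMinimizer a b f lam u) (hv : IsMinimizer a b f lam v)
    (hfu : MemLp (f - u) 2 (vol a b)) (hfv : MemLp (f - v) 2 (vol a b)) :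
    v =ᵐ[vol a b] u := by
  set w : ℝ → ℝ := fun t => 2⁻¹ * (u + v) t with hw
  have hJle : totalVariation a b w
      ≤ ENNReal.ofReal 2⁻¹ * (totalVariation a b u + totalVariation a b v) :=
    (totalVariation_const_mul_le _ (by norm_num)).trans
      (by gcongr; exact totalVariation_add_le hu.1.1 hv.1.1)
  have hJfin : ENNReal.ofReal 2⁻¹ * (totalVariation a b u + totalVariation a b v) ≠ ∞ :=
    ENNReal.mul_ne_top (by simp) (ENNReal.add_ne_top.2 ⟨hu.1.2.ne, hv.1.2.ne⟩)
  have hwBV : MemBV a b w :=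
    ⟨(hu.1.1.add hv.1.1).const_mul _, hJle.trans_lt (lt_top_iff_ne_top.2 hJfin)⟩
  have hwJ : (totalVariation a b w).toReal
      ≤ 2⁻¹ * ((totalVariation a b u).toReal + (totalVariation a b v).toReal) := by
    have := ENNReal.toReal_mono hJfin hJle
    rwa [ENNReal.toReal_mul, ENNReal.toReal_ofReal (by norm_num),
      ENNReal.toReal_add hu.1.2.ne hv.1.2.ne] at this
  have hfw : MemLp (f - w) 2 (vol a b) := by
    have : f - w = fun t => 2⁻¹ * ((f - u) + (f - v)) t := by
      ext t; simp [hw]; ring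
    rw [this]
    exact (hfu.add hfv).const_mul _
  have huv : MemLp (u - v) 2 (vol a b) := by
    have : u - v = (f - v) - (f - u) := by ext t; simp
    rw [this]
    exact hfv.sub hfu
  have hEu := hu.2 w hwBV
  have hEv := hv.2 w hwBV
  have hn : ∀ g : ℝ → ℝ, 0 ≤ ∫ t, g t ^ 2 ∂(vol a b) :=
    fun g => integral_nonneg fun t => sq_nonneg _
  have hnw := hn (f - w)
  simp only [Pi.sub_apply] at hnw
  rw [energy_eq_ofReal hlam.le hu.1.2 hfu, energy_eq_ofReal hlam.le hwBV.2 hfw,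
    ENNReal.ofReal_le_ofReal_iff (by positivity)] at hEu
  rw [energy_eq_ofReal hlam.le hv.1.2 hfv, energy_eq_ofReal hlam.le hwBV.2 hfw,
    ENNReal.ofReal_le_ofReal_iff (by positivity)] at hEv
  -- Parallelogram identity: the midpoint beats the average fidelity by a quarter of `‖u - v‖²`,
  -- which minimality forces to vanish.
  have hi : ∫ t, (f t - w t) ^ 2 ∂(vol a b)
      = 2⁻¹ * ∫ t, (f t - u t) ^ 2 ∂(vol a b) + 2⁻¹ * ∫ t, (f t - v t) ^ 2 ∂(vol a b)
        - 4⁻¹ * ∫ t, (u t - v t) ^ 2 ∂(vol a b) := by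
    have i1 := hfu.integrable_sq
    have i2 := hfv.integrable_sq
    have i3 := huv.integrable_sq
    simp only [Pi.sub_apply] at i1 i2 i3
    rw [← integral_const_mul, ← integral_const_mul, ← integral_const_mul,
      ← integral_add (i1.const_mul _) (i2.const_mul _),
      ← integral_sub (by exact (i1.const_mul _).add (i2.const_mul _)) (i3.const_mul _)]
    refine integral_congr_ae (ae_of_all _ fun t => ?_)
    simp [hw]; ring
  have h0 : ∫ t, (u t - v t) ^ 2 ∂(vol a b) = 0 := by
    have := hn (u - v)
    simp only [Pi.sub_apply] at this
    have := mul_le_mul_of_nonneg_left hwJ hlam.le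
    linarith
  have := (integral_eq_zero_iff_of_nonneg (fun t => sq_nonneg (u t - v t)) huv.integrable_sq).1 h0
  filter_upwards [this] with t ht
  have : u t - v t = 0 := by simpa using ht
  linarith

/-! ### Step functions on a partition -/

/-- The `i`-th open interval of the partition `x`. -/
def piece {n : ℕ} (x : Fin (n + 1) → ℝ) (i : Fin n) : Set ℝ := Ioo (x i.castSucc) (x i.succ)

/-- The step function with value `c i` on the `i`-th interval of the partition `x`. -/
noncomputable def step {n : ℕ} (x : Fin (n + 1) → ℝ) (c : Fin n → ℝ) (t : ℝ) : ℝ :=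
  ∑ i, (piece x i).indicator (fun _ => c i) t

/-- The length of the `i`-th interval of the partition `x`. -/
def len {n : ℕ} (x : Fin (n + 1) → ℝ) (i : Fin n) : ℝ := x i.succ - x i.castSucc

/-- The mean value of `u` over the `i`-th interval of the partition `x`. -/
noncomputable def mean {n : ℕ} (x : Fin (n + 1) → ℝ) (u : ℝ → ℝ) (i : Fin n) : ℝ :=
  (len x i)⁻¹ * ∫ t in piece x i, u t

section

variable {n : ℕ} {x : Fin (n + 1) → ℝ}

lemma measurableSet_piece (i : Fin n) : MeasurableSet (piece x i) := measurableSet_Ioo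

lemma len_pos (hx : StrictMono x) (i : Fin n) : 0 < len x i :=
  sub_pos.2 (hx (Fin.castSucc_lt_succ))

lemma integral_piece (hx : StrictMono x) (g : ℝ → ℝ) (i : Fin n) :
    ∫ t in piece x i, g t = ∫ t in x i.castSucc..x i.succ, g t := by
  rw [piece, intervalIntegral.integral_of_le (hx (Fin.castSucc_lt_succ)).le,
    integral_Ioc_eq_integral_Ioo]

lemma volume_real_piece (hx : StrictMono x) (i : Fin n) : volume.real (piece x i) = len x i := by
  rw [piece, len, Real.volume_real_Ioo_of_le (hx (Fin.castSucc_lt_succ)).le]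

lemma piece_subset (hx : StrictMono x) (i : Fin n) : piece x i ⊆ Ioo (x 0) (x (Fin.last n)) :=
  Ioo_subset_Ioo (hx.monotone (Fin.zero_le _)) (hx.monotone (Fin.le_last _))

/-- The closed piece is taken so that integrals up to a node are covered too. -/
lemma notMem_piece (hx : StrictMono x) {i j : Fin n} (hij : i ≠ j) {t : ℝ}
    (ht : t ∈ Icc (x i.castSucc) (x i.succ)) : t ∉ piece x j := by
  intro ht'
  rcases lt_or_gt_of_ne hij with h | h
  · have : x i.succ ≤ x j.castSucc := hx.monotone (by
      rw [Fin.le_def]; simp only [Fin.val_succ, Fin.val_castSucc]; exact h)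
    linarith [ht.2, ht'.1]
  · have : x j.succ ≤ x i.castSucc := hx.monotone (by
      rw [Fin.le_def]; simp only [Fin.val_succ, Fin.val_castSucc]; exact h)
    linarith [ht'.2, ht.1]

lemma sum_indicator_piece (hx : StrictMono x) (φ : Fin n → ℝ → ℝ) {j : Fin n} {t : ℝ}
    (ht : t ∈ piece x j) : ∑ i, (piece x i).indicator (φ i) t = φ j t := by
  rw [Finset.sum_eq_single j]
  · exact indicator_of_mem ht _
  · intro i _ hij
    exact indicator_of_notMem (notMem_piece hx hij.symm (Ioo_subset_Icc_self ht)) _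
  · simp

lemma step_apply (hx : StrictMono x) (c : Fin n → ℝ) {j : Fin n} {t : ℝ}
    (ht : t ∈ piece x j) : step x c t = c j :=
  sum_indicator_piece hx (fun i _ => c i) ht

lemma step_sub (c d : Fin n → ℝ) : step x (c - d) = step x c - step x d := by
  ext t
  simp only [step, Pi.sub_apply, ← Finset.sum_sub_distrib]
  refine Finset.sum_congr rfl fun i _ => ?_
  by_cases h : t ∈ piece x i <;> simp [h]

/-- A point of the interval which is not a node lies in one of the pieces. -/
lemma exists_mem_piece {t : ℝ} (ht : t ∉ range x) (j : Fin (n + 1)) (h0 : x 0 < t)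
    (hj : t < x j) : ∃ i, t ∈ piece x i := by
  induction j using Fin.induction with
  | zero => exact absurd h0 hj.not_gt
  | succ j ih =>
    rcases lt_trichotomy t (x j.castSucc) with h | h | h
    · exact ih h
    · exact absurd ⟨_, h.symm⟩ ht
    · exact ⟨j, h, hj⟩

lemma ae_exists_mem_piece :
    ∀ᵐ t ∂(vol (x 0) (x (Fin.last n))), ∃ i, t ∈ piece x i := by
  have h1 : ∀ᵐ t ∂(vol (x 0) (x (Fin.last n))), t ∉ range x :=
    ae_restrict_of_ae ((finite_range x).countable.ae_notMem _)
  have h2 : ∀ᵐ t ∂(vol (x 0) (x (Fin.last n))), t ∈ Ioo (x 0) (x (Fin.last n)) :=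
    ae_restrict_mem measurableSet_Ioo
  filter_upwards [h1, h2] with t h1 h2
  exact exists_mem_piece h1 _ h2.1 h2.2

lemma measurable_step (c : Fin n → ℝ) : Measurable (step x c) := by
  unfold step
  exact Finset.measurable_sum _ fun i _ => measurable_const.indicator (measurableSet_piece i)

lemma norm_step_le (c : Fin n → ℝ) (t : ℝ) : ‖step x c t‖ ≤ ∑ i, |c i| := by
  refine (norm_sum_le _ _).trans (Finset.sum_le_sum fun i _ => ?_)
  exact norm_indicator_le_norm_self _ _

lemma memLp_step {a b : ℝ} (c : Fin n → ℝ) (p : ℝ≥0∞) : MemLp (step x c) p (vol a b) :=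
  MemLp.of_bound (measurable_step c).aestronglyMeasurable _ (ae_of_all _ (norm_step_le c))

lemma integrable_step {a b : ℝ} (c : Fin n → ℝ) : Integrable (step x c) (vol a b) :=
  memLp_one_iff_integrable.1 (memLp_step c 1)

lemma integral_indicator_piece (hx : StrictMono x) (g : ℝ → ℝ) (i : Fin n) :
    ∫ t, (piece x i).indicator g t ∂(vol (x 0) (x (Fin.last n))) = ∫ t in piece x i, g t := by
  rw [integral_indicator (measurableSet_piece i), vol,
    Measure.restrict_restrict_of_subset (piece_subset hx i)]

lemma integral_step_mul (hx : StrictMono x) (c : Fin n → ℝ) {g : ℝ → ℝ}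
    (hg : Integrable g (vol (x 0) (x (Fin.last n)))) :
    ∫ t, step x c t * g t ∂(vol (x 0) (x (Fin.last n))) = ∑ i, c i * ∫ t in piece x i, g t := by
  have : ∀ t, step x c t * g t = ∑ i, (piece x i).indicator (fun t => c i * g t) t := by
    intro t
    rw [step, Finset.sum_mul]
    refine Finset.sum_congr rfl fun i _ => ?_
    by_cases h : t ∈ piece x i <;> simp [h]
  simp_rw [this]
  rw [integral_finsetSum _ fun i _ =>
    (hg.const_mul (c i)).indicator (measurableSet_piece i)]
  refine Finset.sum_congr rfl fun i _ => ?_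
  rw [integral_indicator_piece hx, integral_const_mul]

lemma integral_eq_sum_piece (hx : StrictMono x) {g : ℝ → ℝ}
    (hg : Integrable g (vol (x 0) (x (Fin.last n)))) :
    ∫ t, g t ∂(vol (x 0) (x (Fin.last n))) = ∑ i, ∫ t in piece x i, g t := by
  have := integral_step_mul hx (fun _ => 1) hg
  simp only [one_mul] at this
  rw [← this]
  refine integral_congr_ae ?_
  filter_upwards [ae_exists_mem_piece (x := x)] with t ⟨i, hi⟩
  rw [step_apply hx _ hi, one_mul]

lemma integral_step_sq (hx : StrictMono x) (c : Fin n → ℝ) :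
    ∫ t, step x c t ^ 2 ∂(vol (x 0) (x (Fin.last n))) = ∑ i, len x i * c i ^ 2 := by
  rw [integral_eq_sum_piece hx (memLp_step c 2).integrable_sq]
  refine Finset.sum_congr rfl fun i _ => ?_
  rw [setIntegral_congr_fun (g := fun _ => c i ^ 2) (measurableSet_piece i)
    (fun t ht => by simp only [step_apply hx c ht])]
  simp [volume_real_piece hx]

/-- Replacing `u` by its mean values decreases the distance to a step function. -/
lemma eLpNorm_step_sub_step_mean_le (hx : StrictMono x) (d : Fin n → ℝ) {u : ℝ → ℝ}
    (hu : Integrable u (vol (x 0) (x (Fin.last n)))) :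
    eLpNorm (step x d - step x (mean x u)) 2 (vol (x 0) (x (Fin.last n))) ^ 2
      ≤ eLpNorm (step x d - u) 2 (vol (x 0) (x (Fin.last n))) ^ 2 := by
  -- `u` is only integrable; if the difference is not in `L²`, the right side is `∞`.
  by_cases hm : MemLp (step x d - u) 2 (vol (x 0) (x (Fin.last n)))
  · rw [← step_sub, eLpNorm_two_sq (memLp_step _ _), eLpNorm_two_sq hm]
    refine ENNReal.ofReal_le_ofReal ?_
    rw [integral_step_sq hx, integral_eq_sum_piece hx hm.integrable_sq]
    refine Finset.sum_le_sum fun i _ => ?_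
    have hl := len_pos hx i
    have hmono : volume.restrict (piece x i) ≤ vol (x 0) (x (Fin.last n)) :=
      Measure.restrict_mono (piece_subset hx i) le_rfl
    have i1 : Integrable u (volume.restrict (piece x i)) := hu.mono_measure hmono
    have i2 : Integrable (fun t => (d i - u t) ^ 2) (volume.restrict (piece x i)) := by
      have := hm.integrable_sq.mono_measure hmono
      refine this.congr ?_
      filter_upwards [ae_restrict_mem (measurableSet_piece i)] with t ht
      simp [step_apply hx d ht]
    have e2 : ∫ t in piece x i, (step x d - u) t ^ 2 = ∫ t in piece x i, (d i - u t) ^ 2 :=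
      setIntegral_congr_fun (measurableSet_piece i)
        (fun t ht => by simp only [Pi.sub_apply, step_apply hx d ht])
    have : IsFiniteMeasure (volume.restrict (piece x i)) := by unfold piece; infer_instance
    set m := (d - mean x u) i with hm'
    have e1 : ∫ t in piece x i, (d i - u t) = len x i * m := by
      rw [integral_sub (integrable_const _) i1]
      simp only [integral_const, measureReal_restrict_apply_univ, volume_real_piece hx,
        smul_eq_mul, hm', Pi.sub_apply, mean, mul_sub]
      rw [mul_inv_cancel_left₀ hl.ne']
    have i3 : Integrable (fun t => d i - u t) (volume.restrict (piece x i)) :=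
      (integrable_const _).sub i1
    -- The variance of `d i - u`, whose mean is `m`, is nonnegative.
    have h0 : 0 ≤ ∫ t in piece x i, ((d i - u t) ^ 2 - 2 * m * (d i - u t) + m ^ 2) :=
      integral_nonneg fun t => by
        have := sq_nonneg (d i - u t - m)
        show (0 : ℝ) ≤ (d i - u t) ^ 2 - 2 * m * (d i - u t) + m ^ 2
        linarith
    rw [integral_add (by exact i2.sub (i3.const_mul _)) (integrable_const _),
      integral_sub i2 (i3.const_mul _), integral_const_mul, e1] at h0
    simp only [integral_const, measureReal_restrict_apply_univ, volume_real_piece hx,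
      smul_eq_mul] at h0
    rw [e2]
    linarith
  · have hmeas : AEStronglyMeasurable (step x d - u) (vol (x 0) (x (Fin.last n))) :=
      (measurable_step d).aestronglyMeasurable.sub hu.1
    have : eLpNorm (step x d - u) 2 (vol (x 0) (x (Fin.last n))) = ∞ := by
      by_contra h
      exact hm ⟨hmeas, lt_top_iff_ne_top.2 h⟩
    rw [this]
    simp

/-! ### Total variation and energy as functions of the coefficients -/

lemma integral_piece_deriv (hx : StrictMono x) {a b : ℝ} {ξ : ℝ → ℝ} (h : IsTest a b ξ)
    (i : Fin n) : ∫ t in piece x i, deriv ξ t = ξ (x i.succ) - ξ (x i.castSucc) := by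
  rw [integral_piece hx]
  exact intervalIntegral.integral_deriv_eq_sub
    (fun t _ => (h.1.differentiable (by norm_num)).differentiableAt)
    (h.continuous_deriv.intervalIntegrable _ _)

lemma IsTest.integrable_deriv {a b a' b' : ℝ} {ξ : ℝ → ℝ} (h : IsTest a b ξ) :
    Integrable (deriv ξ) (vol a' b') := by
  obtain ⟨C, hC⟩ := h.exists_bound_deriv
  exact Integrable.of_bound h.continuous_deriv.aestronglyMeasurable C (ae_of_all _ hC)

/-- A test function changes by at most 2 across a piece. The sum of the jumps would be sharper, but
a bound linear in the coefficients suffices. -/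
lemma totalVariation_step_le (hx : StrictMono x) (c : Fin n → ℝ) :
    totalVariation (x 0) (x (Fin.last n)) (step x c) ≤ ENNReal.ofReal (∑ i, 2 * |c i|) := by
  refine totalVariation_le fun ξ hξ => ENNReal.ofReal_le_ofReal ?_
  rw [integral_step_mul hx c hξ.integrable_deriv]
  refine Finset.sum_le_sum fun i _ => ?_
  rw [integral_piece_deriv hx hξ]
  refine (le_abs_self _).trans ?_
  rw [abs_mul, mul_comm]
  gcongr
  refine (abs_sub _ _).trans ?_
  linarith [hξ.2.2.2 (x i.succ), hξ.2.2.2 (x i.castSucc)]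

lemma totalVariation_step_lt_top (hx : StrictMono x) (c : Fin n → ℝ) :
    totalVariation (x 0) (x (Fin.last n)) (step x c) < ∞ :=
  (totalVariation_step_le hx c).trans_lt ENNReal.ofReal_lt_top

lemma memBV_step (hx : StrictMono x) (c : Fin n → ℝ) :
    MemBV (x 0) (x (Fin.last n)) (step x c) :=
  ⟨integrable_step c, totalVariation_step_lt_top hx c⟩

/-- Subadditivity for `c = d + (c - d)`. This Lipschitz bound serves both the existence of a
minimizer and the linear rate. -/
lemma toReal_totalVariation_step_le (hx : StrictMono x) (c d : Fin n → ℝ) :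
    (totalVariation (x 0) (x (Fin.last n)) (step x c)).toReal
      ≤ (totalVariation (x 0) (x (Fin.last n)) (step x d)).toReal + ∑ i, 2 * |c i - d i| := by
  have h : step x c = step x d + step x (c - d) := by rw [step_sub]; abel
  have h1 := (totalVariation_add_le (integrable_step (x := x) d)
    (integrable_step (x := x) (a := x 0) (b := x (Fin.last n)) (c - d)))
  rw [← h] at h1
  have h2 := ENNReal.toReal_mono (ENNReal.add_ne_top.2
    ⟨(totalVariation_step_lt_top hx d).ne, (totalVariation_step_lt_top hx (c - d)).ne⟩) h1
  rw [ENNReal.toReal_add (totalVariation_step_lt_top hx d).ne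
    (totalVariation_step_lt_top hx (c - d)).ne] at h2
  have h3 := ENNReal.toReal_mono ENNReal.ofReal_ne_top (totalVariation_step_le hx (c - d))
  rw [ENNReal.toReal_ofReal (Finset.sum_nonneg fun i _ => by positivity)] at h3
  simp only [Pi.sub_apply] at h3
  linarith

lemma continuous_totalVariation_step (hx : StrictMono x) : Continuous fun c : Fin n → ℝ =>
    (totalVariation (x 0) (x (Fin.last n)) (step x c)).toReal := by
  rw [continuous_iff_continuousAt]
  intro d
  have h : Tendsto (fun c : Fin n → ℝ => ∑ i, 2 * |c i - d i|) (𝓝 d) (𝓝 0) := by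
    have : Continuous (fun c : Fin n → ℝ => ∑ i, 2 * |c i - d i|) := by fun_prop
    simpa using this.tendsto d
  refine tendsto_iff_dist_tendsto_zero.2 (squeeze_zero (fun _ => dist_nonneg) (fun c => ?_) h)
  rw [Real.dist_eq, abs_sub_le_iff]
  have h1 := toReal_totalVariation_step_le hx c d
  have h2 := toReal_totalVariation_step_le hx d c
  simp_rw [abs_sub_comm (d _)] at h2
  constructor <;> linarith

/-- The energy of a step function with respect to step data. -/
lemma energy_step (hx : StrictMono x) (d c : Fin n → ℝ) {lam : ℝ} (hlam : 0 ≤ lam) :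
    energy (x 0) (x (Fin.last n)) (step x d) lam (step x c) = ENNReal.ofReal
      (lam * (totalVariation (x 0) (x (Fin.last n)) (step x c)).toReal
        + 2⁻¹ * ∑ i, len x i * (d i - c i) ^ 2) := by
  rw [energy_eq_ofReal hlam (totalVariation_step_lt_top hx c)
    ((memLp_step d 2).sub (memLp_step c 2))]
  have := integral_step_sq hx (d - c)
  rw [step_sub] at this
  simp only [Pi.sub_apply] at this
  rw [this]

/-- Among step functions the energy attains its minimum. -/
lemma exists_step_energy_le (hx : StrictMono x) (d : Fin n → ℝ) {lam : ℝ} (hlam : 0 < lam) :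
    ∃ c, ∀ c', energy (x 0) (x (Fin.last n)) (step x d) lam (step x c)
      ≤ energy (x 0) (x (Fin.last n)) (step x d) lam (step x c') := by
  set G : (Fin n → ℝ) → ℝ := fun c =>
    lam * (totalVariation (x 0) (x (Fin.last n)) (step x c)).toReal
      + 2⁻¹ * ∑ i, len x i * (d i - c i) ^ 2 with hG
  have hcont : Continuous G := by
    have := continuous_totalVariation_step hx
    fun_prop
  have hev : ∀ᶠ c in cocompact (Fin n → ℝ), G d ≤ G c := by
    -- If `G c < G d`, then `(d i - c i) ^ 2` is at most `R i - 1`; the inequality `y ≤ y² + 1` then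
    -- bounds `|d i - c i|` without a root.
    set R : Fin n → ℝ := fun i => 2 * (len x i)⁻¹ * G d + 1 with hR
    have hK : IsCompact (Set.pi univ fun i => Icc (d i - R i) (d i + R i)) :=
      isCompact_univ_pi fun i => isCompact_Icc
    filter_upwards [hK.compl_mem_cocompact] with c hc
    contrapose! hc
    simp only [mem_compl_iff, not_not, mem_univ_pi]
    intro i
    have hl := len_pos hx i
    have h1 : len x i * (d i - c i) ^ 2 ≤ ∑ i, len x i * (d i - c i) ^ 2 :=
      Finset.single_le_sum (f := fun i => len x i * (d i - c i) ^ 2)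
        (fun j _ => mul_nonneg (len_pos hx j).le (sq_nonneg _)) (Finset.mem_univ i)
    have h2 : 0 ≤ lam * (totalVariation (x 0) (x (Fin.last n)) (step x c)).toReal := by positivity
    have h3 : len x i * (d i - c i) ^ 2 ≤ 2 * G d := by
      simp only [hG] at hc ⊢
      linarith
    have h4 : (d i - c i) ^ 2 ≤ 2 * (len x i)⁻¹ * G d := by
      rw [mul_assoc, mul_left_comm, ← div_eq_inv_mul, le_div_iff₀ hl]
      linarith
    have h5 : |d i - c i| ≤ R i := by
      have := sq_abs (d i - c i)
      simp only [hR]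
      nlinarith [sq_nonneg (|d i - c i| - 1), abs_nonneg (d i - c i)]
    rw [abs_le] at h5
    exact ⟨by linarith, by linarith⟩
  obtain ⟨c, hc⟩ := hcont.exists_forall_le' d hev
  refine ⟨c, fun c' => ?_⟩
  rw [energy_step hx d _ hlam.le, energy_step hx d _ hlam.le]
  exact ENNReal.ofReal_le_ofReal (hc c')

end

/-! ### Averaging decreases the total variation -/

/-- A continuous function with compact support in `(a, b)` and vanishing integral whose primitive
is bounded by one is an admissible derivative in the definition of the total variation. -/
lemma ofReal_integral_mul_le_totalVariation {a b δ : ℝ} (hδ : 0 < δ) {g : ℝ → ℝ}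
    (hg : Continuous g) (hg0 : ∀ t, g t ≠ 0 → t ∈ Icc (a + δ) (b - δ))
    (hint : ∫ t in a..b, g t = 0) (hbd : ∀ t ∈ Icc a b, |∫ s in a..t, g s| ≤ 1) (u : ℝ → ℝ) :
    ENNReal.ofReal (∫ t, u t * g t ∂(vol a b)) ≤ totalVariation a b u := by
  set η : ℝ → ℝ := fun t => ∫ s in a..t, g s with hη
  have hderiv : deriv η = g := funext fun t => hg.deriv_integral g a t
  have hdiff : Differentiable ℝ η := fun t =>
    (intervalIntegral.integral_hasDerivAt_right (hg.intervalIntegrable _ _)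
      (hg.stronglyMeasurableAtFilter _ _) hg.continuousAt).differentiableAt
  have hzero : ∀ p t : ℝ, (∀ s ∈ uIcc p t, s ∉ Icc (a + δ) (b - δ)) → ∫ s in p..t, g s = 0 := by
    intro p t h
    rw [intervalIntegral.integral_congr (g := fun _ => 0) fun s hs => by
      by_contra h'
      exact h s hs (hg0 s h')]
    simp
  have hleft : ∀ t, t < a + δ → η t = 0 := fun t ht => hzero a t fun s hs h => by
    have : s ≤ max a t := hs.2
    have : max a t < a + δ := max_lt (by linarith) ht
    linarith [h.1]
  -- The vanishing total integral brings the primitive back to zero.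
  have hright : ∀ t, b - δ < t → η t = 0 := fun t ht => by
    have : η t = (∫ s in a..b, g s) + ∫ s in b..t, g s :=
      (intervalIntegral.integral_add_adjacent_intervals (hg.intervalIntegrable _ _)
        (hg.intervalIntegrable _ _)).symm
    rw [this, hint, hzero b t fun s hs h => ?_, add_zero]
    have : min b t ≤ s := hs.1
    have : b - δ < min b t := lt_min (by linarith) ht
    linarith [h.2]
  have hout : ∀ t, t ∉ Icc (a + δ) (b - δ) → η t = 0 := fun t ht => by
    by_cases h : t < a + δ
    · exact hleft t h
    · exact hright t (by_contra fun h' => ht ⟨not_lt.1 h, not_lt.1 h'⟩)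
  have hsub : tsupport η ⊆ Icc (a + δ) (b - δ) :=
    closure_minimal (fun t ht => by_contra fun h => ht (hout t h)) isClosed_Icc
  have htest : IsTest a b η := by
    refine ⟨contDiff_one_iff_deriv.2 ⟨hdiff, hderiv ▸ hg⟩, HasCompactSupport.intro isCompact_Icc hout,
      hsub.trans (Icc_subset_Ioo (by linarith) (by linarith)), fun t => ?_⟩
    by_cases ht : t ∈ Icc (a + δ) (b - δ)
    · exact hbd t ⟨by linarith [ht.1], by linarith [ht.2]⟩
    · simp [hout t ht]
  have := htest.le_totalVariation u
  rwa [hderiv] at this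

/-! ### Smoothed interpolation of a test function at the nodes -/

section

variable {n : ℕ} {x : Fin (n + 1) → ℝ}

/-- Continuous functions with compact support in the `i`-th piece, increasing to its indicator. -/
noncomputable def cutoff (x : Fin (n + 1) → ℝ) (k : ℕ) (i : Fin n) (t : ℝ) : ℝ :=
  max 0 (min 1 (k * ((t - x i.castSucc) * (x i.succ - t)) - 1))

lemma continuous_cutoff (k : ℕ) (i : Fin n) : Continuous (cutoff x k i) := by
  unfold cutoff; fun_prop

lemma cutoff_nonneg (k : ℕ) (i : Fin n) (t : ℝ) : 0 ≤ cutoff x k i t := le_max_left _ _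

lemma cutoff_le_one (k : ℕ) (i : Fin n) (t : ℝ) : cutoff x k i t ≤ 1 :=
  max_le zero_le_one (min_le_left _ _)

/-- The `- 1` in `cutoff` keeps its support at a positive distance from the end points. -/
lemma one_lt_of_cutoff_ne_zero {k : ℕ} {i : Fin n} {t : ℝ} (h : cutoff x k i t ≠ 0) :
    1 < k * ((t - x i.castSucc) * (x i.succ - t)) := by
  contrapose! h
  exact max_eq_left ((min_le_right _ _).trans (by linarith))

lemma mem_piece_of_cutoff_ne_zero (hx : StrictMono x) {k : ℕ} {i : Fin n} {t : ℝ}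
    (h : cutoff x k i t ≠ 0) : t ∈ piece x i := by
  have h1 : 0 < (t - x i.castSucc) * (x i.succ - t) :=
    pos_of_mul_pos_right (zero_lt_one.trans (one_lt_of_cutoff_ne_zero h)) k.cast_nonneg
  have h2 := len_pos hx i
  unfold len at h2
  rcases pos_and_pos_or_neg_and_neg_of_mul_pos h1 with h3 | h3
  · exact ⟨by linarith, by linarith⟩
  · linarith

lemma tendsto_cutoff (hx : StrictMono x) (i : Fin n) (t : ℝ) :
    Tendsto (fun k => cutoff x k i t) atTop (𝓝 ((piece x i).indicator (fun _ => 1) t)) := by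
  by_cases ht : t ∈ piece x i
  · rw [indicator_of_mem ht]
    have hpos : 0 < (t - x i.castSucc) * (x i.succ - t) :=
      mul_pos (sub_pos.2 ht.1) (sub_pos.2 ht.2)
    obtain ⟨K, hK⟩ := exists_nat_gt (2 / ((t - x i.castSucc) * (x i.succ - t)))
    refine tendsto_const_nhds.congr' ?_
    filter_upwards [eventually_ge_atTop K] with k hk
    have : (2 : ℝ) ≤ k * ((t - x i.castSucc) * (x i.succ - t)) := by
      rw [← div_le_iff₀ hpos]
      exact hK.le.trans (by exact_mod_cast hk)
    rw [cutoff, min_eq_left (by linarith), max_eq_right zero_le_one]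
  · rw [indicator_of_notMem ht]
    refine tendsto_const_nhds.congr fun k => ?_
    by_contra h
    exact ht (mem_piece_of_cutoff_ne_zero hx (Ne.symm h))

lemma tendsto_integral_mul_cutoff (hx : StrictMono x) {u : ℝ → ℝ}
    (hu : Integrable u (vol (x 0) (x (Fin.last n)))) (i : Fin n) :
    Tendsto (fun k => ∫ t, u t * cutoff x k i t ∂(vol (x 0) (x (Fin.last n)))) atTop
      (𝓝 (∫ t in piece x i, u t)) := by
  rw [← integral_indicator_piece hx]
  refine tendsto_integral_of_dominated_convergence (fun t => ‖u t‖)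
    (fun k => hu.1.mul (continuous_cutoff k i).aestronglyMeasurable) hu.norm
    (fun k => ae_of_all _ fun t => ?_) (ae_of_all _ fun t => ?_)
  · rw [norm_mul, Real.norm_of_nonneg (cutoff_nonneg k i t)]
    exact mul_le_of_le_one_right (norm_nonneg _) (cutoff_le_one k i t)
  · have := (tendsto_cutoff hx i t).const_mul (u t)
    rwa [show u t * (piece x i).indicator (fun _ => 1) t = (piece x i).indicator u t by
      by_cases h : t ∈ piece x i <;> simp [h]] at this

/-- The mass of a cutoff function. -/
noncomputable def mass (x : Fin (n + 1) → ℝ) (k : ℕ) (i : Fin n) : ℝ :=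
  ∫ t in x i.castSucc..x i.succ, cutoff x k i t

lemma tendsto_mass (hx : StrictMono x) (i : Fin n) :
    Tendsto (fun k => mass x k i) atTop (𝓝 (len x i)) := by
  have h := tendsto_integral_mul_cutoff hx (u := fun _ => 1) (integrable_const _) i
  simp only [one_mul, integral_const, measureReal_restrict_apply_univ, volume_real_piece hx,
    smul_eq_mul, mul_one] at h
  refine h.congr fun k => ?_
  rw [mass, ← integral_piece hx, ← integral_indicator_piece hx]
  refine integral_congr_ae (ae_of_all _ fun t => ?_)
  by_cases ht : t ∈ piece x i
  · simp [ht]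
  · simp only [ht, not_false_eq_true, indicator_of_notMem]
    by_contra h
    exact ht (mem_piece_of_cutoff_ne_zero hx h)

/-- The derivative of the smoothed interpolation of `ξ` at the nodes `x`. -/
noncomputable def slope (x : Fin (n + 1) → ℝ) (ξ : ℝ → ℝ) (k : ℕ) (t : ℝ) : ℝ :=
  ∑ i, (ξ (x i.succ) - ξ (x i.castSucc)) / mass x k i * cutoff x k i t

lemma continuous_slope (ξ : ℝ → ℝ) (k : ℕ) : Continuous (slope x ξ k) := by
  unfold slope
  exact continuous_finsetSum _ fun i _ => (continuous_cutoff k i).const_mul _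

lemma slope_apply (hx : StrictMono x) (ξ : ℝ → ℝ) (k : ℕ) {i : Fin n} {t : ℝ}
    (ht : t ∈ Icc (x i.castSucc) (x i.succ)) :
    slope x ξ k t = (ξ (x i.succ) - ξ (x i.castSucc)) / mass x k i * cutoff x k i t := by
  refine Finset.sum_eq_single i (fun j _ hij => ?_) (by simp)
  by_contra h
  exact notMem_piece hx hij.symm ht (mem_piece_of_cutoff_ne_zero hx (right_ne_zero_of_mul h))

/-- On each closed piece the smoothed interpolation moves monotonically between the values of
`ξ` at the end points. -/
lemma exists_integral_slope_eq (hx : StrictMono x) (ξ : ℝ → ℝ) {k : ℕ} {i : Fin n}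
    (hm : 0 < mass x k i) {t : ℝ} (ht : t ∈ Icc (x i.castSucc) (x i.succ)) :
    ∃ θ ∈ Icc (0 : ℝ) 1, (t = x i.succ → θ = 1) ∧
      ∫ s in x i.castSucc..t, slope x ξ k s = (ξ (x i.succ) - ξ (x i.castSucc)) * θ := by
  have hi : ∀ p q, IntervalIntegrable (cutoff x k i) volume p q :=
    fun p q => (continuous_cutoff k i).intervalIntegrable p q
  have h0 : ∀ p q, p ≤ q → 0 ≤ ∫ s in p..q, cutoff x k i s := fun p q hpq =>
    intervalIntegral.integral_nonneg hpq fun s _ => cutoff_nonneg k i s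
  refine ⟨(∫ s in x i.castSucc..t, cutoff x k i s) / mass x k i,
    ⟨div_nonneg (h0 _ _ ht.1) hm.le, ?_⟩, ?_, ?_⟩
  · rw [div_le_one hm, mass,
      ← intervalIntegral.integral_add_adjacent_intervals (hi _ t) (hi t (x i.succ))]
    linarith [h0 _ _ ht.2]
  · rintro rfl
    exact div_self hm.ne'
  · rw [intervalIntegral.integral_congr (g := fun s =>
      (ξ (x i.succ) - ξ (x i.castSucc)) / mass x k i * cutoff x k i s) fun s hs => ?_]
    · rw [intervalIntegral.integral_const_mul]
      ring
    · rw [uIcc_of_le ht.1] at hs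
      exact slope_apply hx ξ k ⟨hs.1, hs.2.trans ht.2⟩

/-- Division by the mass makes each piece contribute exactly the increment of `ξ`; the sum
telescopes. -/
lemma integral_slope_node (hx : StrictMono x) (ξ : ℝ → ℝ) {k : ℕ} (hm : ∀ i, 0 < mass x k i)
    (j : Fin (n + 1)) : ∫ s in x 0..x j, slope x ξ k s = ξ (x j) - ξ (x 0) := by
  have hi : ∀ p q, IntervalIntegrable (slope x ξ k) volume p q :=
    fun p q => (continuous_slope ξ k).intervalIntegrable p q
  induction j using Fin.induction with
  | zero => simp
  | succ j ih =>
    obtain ⟨θ, -, h1, h2⟩ := exists_integral_slope_eq hx ξ (hm j)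
      (right_mem_Icc.2 (hx (Fin.castSucc_lt_succ (i := j))).le)
    rw [← intervalIntegral.integral_add_adjacent_intervals (hi _ (x j.castSucc)) (hi _ _), ih, h2,
      h1 rfl]
    ring

/-- Between two adjacent nodes the primitive is a convex combination of the values of `ξ` there. -/
lemma abs_integral_slope_le (hx : StrictMono x) {ξ : ℝ → ℝ} (h0 : ξ (x 0) = 0)
    (h1 : ∀ t, |ξ t| ≤ 1) {k : ℕ} (hm : ∀ i, 0 < mass x k i) (j : Fin (n + 1)) :
    ∀ t ∈ Icc (x 0) (x j), |∫ s in x 0..t, slope x ξ k s| ≤ 1 := by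
  have hi : ∀ p q, IntervalIntegrable (slope x ξ k) volume p q :=
    fun p q => (continuous_slope ξ k).intervalIntegrable p q
  induction j using Fin.induction with
  | zero =>
    intro t ht
    rw [le_antisymm ht.2 ht.1]
    simp
  | succ j ih =>
    intro t ht
    rcases le_total t (x j.castSucc) with h | h
    · exact ih t ⟨ht.1, h⟩
    · obtain ⟨θ, hθ, -, h2⟩ := exists_integral_slope_eq hx ξ (hm j) ⟨h, ht.2⟩
      rw [← intervalIntegral.integral_add_adjacent_intervals (hi _ (x j.castSucc)) (hi _ _),
        integral_slope_node hx ξ hm, h2, h0, abs_le]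
      have ha := abs_le.1 (h1 (x j.castSucc))
      have hb := abs_le.1 (h1 (x j.succ))
      constructor <;> nlinarith [hθ.1, hθ.2]

/-- Where a cutoff is nonzero, `k` times the product of the distances to the ends of its piece
exceeds 1. Each distance is at most the total length `L`, so the other exceeds `1 / (k L)`. -/
lemma exists_slope_support (hx : StrictMono x) (hn : x 0 < x (Fin.last n)) (ξ : ℝ → ℝ) {k : ℕ}
    (hk : 0 < k) : ∃ δ > 0, ∀ t, slope x ξ k t ≠ 0 → t ∈ Icc (x 0 + δ) (x (Fin.last n) - δ) := by
  have hk' : (0 : ℝ) < k := by exact_mod_cast hk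
  have hL : 0 < x (Fin.last n) - x 0 := sub_pos.2 hn
  refine ⟨1 / (k * (x (Fin.last n) - x 0)), by positivity, fun t ht => ?_⟩
  obtain ⟨i, -, hi⟩ := Finset.exists_ne_zero_of_sum_ne_zero ht
  have hc := right_ne_zero_of_mul hi
  have hp := mem_piece_of_cutoff_ne_zero hx hc
  have hI := piece_subset hx i hp
  have h1 := one_lt_of_cutoff_ne_zero hc
  have hl : x 0 ≤ x i.castSucc := hx.monotone (Fin.zero_le _)
  have hr : x i.succ ≤ x (Fin.last n) := hx.monotone (Fin.le_last _)
  have h2 : (t - x i.castSucc) * (x i.succ - t) ≤ (t - x 0) * (x (Fin.last n) - x 0) :=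
    mul_le_mul (by linarith) (by linarith [hI.1]) (by linarith [hp.2]) (by linarith [hI.1])
  have h3 : (t - x i.castSucc) * (x i.succ - t) ≤ (x (Fin.last n) - x 0) * (x (Fin.last n) - t) :=
    mul_le_mul (by linarith [hI.2]) (by linarith) (by linarith [hp.2]) (by linarith)
  have h4 := mul_le_mul_of_nonneg_left h2 hk'.le
  have h5 := mul_le_mul_of_nonneg_left h3 hk'.le
  have h6 : 1 / (k * (x (Fin.last n) - x 0)) ≤ t - x 0 := by
    rw [div_le_iff₀ (by positivity)]; nlinarith
  have h7 : 1 / (k * (x (Fin.last n) - x 0)) ≤ x (Fin.last n) - t := by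
    rw [div_le_iff₀ (by positivity)]; nlinarith
  exact ⟨by linarith, by linarith⟩

/-- Replacing `u` by its mean values decreases the total variation. -/
lemma totalVariation_step_mean_le (hx : StrictMono x) (hn : x 0 < x (Fin.last n)) {u : ℝ → ℝ}
    (hu : Integrable u (vol (x 0) (x (Fin.last n)))) :
    totalVariation (x 0) (x (Fin.last n)) (step x (mean x u))
      ≤ totalVariation (x 0) (x (Fin.last n)) u := by
  refine totalVariation_le fun ξ hξ => ?_
  rw [integral_step_mul hx _ hξ.integrable_deriv]
  -- Averaging is moved from `u` to `ξ'`: the limit pairs `u` with the derivative of the piecewise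
  -- linear interpolant of `ξ`.
  have hlim : Tendsto (fun k => ∫ t, u t * slope x ξ k t ∂(vol (x 0) (x (Fin.last n)))) atTop
      (𝓝 (∑ i, mean x u i * ∫ t in piece x i, deriv ξ t)) := by
    have h : Tendsto (fun k => ∑ i, (ξ (x i.succ) - ξ (x i.castSucc)) / mass x k i *
        ∫ t, u t * cutoff x k i t ∂(vol (x 0) (x (Fin.last n)))) atTop
        (𝓝 (∑ i, (ξ (x i.succ) - ξ (x i.castSucc)) / len x i * ∫ t in piece x i, u t)) :=
      tendsto_finsetSum _ fun i _ =>
        (tendsto_const_nhds.div (tendsto_mass hx i) (len_pos hx i).ne').mul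
          (tendsto_integral_mul_cutoff hx hu i)
    have e : ∑ i, mean x u i * ∫ t in piece x i, deriv ξ t
        = ∑ i, (ξ (x i.succ) - ξ (x i.castSucc)) / len x i * ∫ t in piece x i, u t := by
      refine Finset.sum_congr rfl fun i _ => ?_
      rw [integral_piece_deriv hx hξ, mean]
      ring
    rw [e]
    refine h.congr fun k => ?_
    simp_rw [slope, Finset.mul_sum, mul_left_comm (u _)]
    rw [integral_finsetSum _ fun i _ => ?_]
    · simp_rw [integral_const_mul]
    · refine Integrable.const_mul (hu.mul_bdd (c := 1)
        (continuous_cutoff k i).aestronglyMeasurable (ae_of_all _ fun t => ?_)) _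
      rw [Real.norm_of_nonneg (cutoff_nonneg k i t)]
      exact cutoff_le_one k i t
  refine le_of_tendsto ((ENNReal.continuous_ofReal.tendsto _).comp hlim) ?_
  -- For small `k` a mass may be zero and the quotient in `slope` a default value; only large `k`
  -- matter.
  have hm : ∀ᶠ k in atTop, ∀ i, 0 < mass x k i :=
    eventually_all.2 fun i => (tendsto_mass hx i).eventually_const_lt (len_pos hx i)
  have ha : ξ (x 0) = 0 := hξ.apply_eq_zero (by simp)
  have hb : ξ (x (Fin.last n)) = 0 := hξ.apply_eq_zero (by simp)
  filter_upwards [hm, eventually_gt_atTop 0] with k hm hk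
  obtain ⟨δ, hδ, hs⟩ := exists_slope_support hx hn ξ hk
  exact ofReal_integral_mul_le_totalVariation hδ (continuous_slope ξ k) hs
    (by rw [integral_slope_node hx ξ hm, ha, hb, sub_zero])
    (abs_integral_slope_le hx ha hξ.2.2.2 hm _) u

/-! ### Minimizers for step data -/

/-- Replacing `u` by its mean values decreases the energy with respect to step data. -/
lemma energy_step_mean_le (hx : StrictMono x) (hn : x 0 < x (Fin.last n)) (d : Fin n → ℝ)
    (lam : ℝ) {u : ℝ → ℝ} (hu : Integrable u (vol (x 0) (x (Fin.last n)))) :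
    energy (x 0) (x (Fin.last n)) (step x d) lam (step x (mean x u))
      ≤ energy (x 0) (x (Fin.last n)) (step x d) lam u := by
  unfold energy
  exact add_le_add (mul_le_mul_right (totalVariation_step_mean_le hx hn hu) _)
    (mul_le_mul_right (eLpNorm_step_sub_step_mean_le hx d hu) _)

lemma exists_isMinimizer_step (hx : StrictMono x) (hn : x 0 < x (Fin.last n)) (d : Fin n → ℝ)
    {lam : ℝ} (hlam : 0 < lam) :
    ∃ c, IsMinimizer (x 0) (x (Fin.last n)) (step x d) lam (step x c) := by
  obtain ⟨c, hc⟩ := exists_step_energy_le hx d hlam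
  exact ⟨c, memBV_step hx c, fun v hv => (hc _).trans (energy_step_mean_le hx hn d lam hv.1)⟩

/-- The datum is itself a competitor of finite energy, so the fidelity of a minimizer is finite. -/
lemma IsMinimizer.memLp_sub (hx : StrictMono x) {d : Fin n → ℝ} {lam : ℝ} (hlam : 0 < lam)
    {u : ℝ → ℝ} (hu : IsMinimizer (x 0) (x (Fin.last n)) (step x d) lam u) :
    MemLp (step x d - u) 2 (vol (x 0) (x (Fin.last n))) := by
  refine ⟨(measurable_step d).aestronglyMeasurable.sub hu.1.1.1, ?_⟩
  have h : energy (x 0) (x (Fin.last n)) (step x d) lam u < ∞ :=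
    (hu.2 _ (memBV_step hx d)).trans_lt (by
      rw [energy_step hx d d hlam.le]
      exact ENNReal.ofReal_lt_top)
  by_contra hc
  rw [energy, not_lt_top_iff.1 hc] at h
  simp at h

/-- A minimizer among step functions satisfies a bound linear in the parameter. -/
lemma sqrt_sum_le_of_isMinimizer (hx : StrictMono x) {d c : Fin n → ℝ} {lam : ℝ}
    (hlam : 0 < lam) (hc : IsMinimizer (x 0) (x (Fin.last n)) (step x d) lam (step x c)) :
    √(∑ i, len x i * (d i - c i) ^ 2) ≤ 2 * (∑ i, 2 / √(len x i)) * lam := by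
  have h := hc.2 _ (memBV_step hx d)
  have hs : 0 ≤ ∑ i, len x i * (d i - c i) ^ 2 :=
    Finset.sum_nonneg fun i _ => mul_nonneg (len_pos hx i).le (sq_nonneg _)
  rw [energy_step hx d d hlam.le, energy_step hx d c hlam.le,
    ENNReal.ofReal_le_ofReal_iff (by simp; positivity)] at h
  simp only [sub_self, ne_eq, OfNat.ofNat_ne_zero, not_false_eq_true, zero_pow, mul_zero,
    Finset.sum_const_zero, add_zero] at h
  have hJ := mul_le_mul_of_nonneg_left (toReal_totalVariation_step_le hx d c) hlam.le
  set N := √(∑ i, len x i * (d i - c i) ^ 2) with hN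
  have hN0 : 0 ≤ N := Real.sqrt_nonneg _
  have hNsq : N * N = ∑ i, len x i * (d i - c i) ^ 2 := Real.mul_self_sqrt hs
  -- Each summand of `N²` alone gives `√(len x i) * |d i - c i| ≤ N`.
  have hsum : ∑ i, 2 * |d i - c i| ≤ (∑ i, 2 / √(len x i)) * N := by
    rw [Finset.sum_mul]
    refine Finset.sum_le_sum fun i _ => ?_
    have hl := Real.sqrt_pos.2 (len_pos hx i)
    rw [div_mul_eq_mul_div, le_div_iff₀ hl, mul_assoc]
    gcongr
    refine Real.le_sqrt_of_sq_le ?_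
    rw [mul_pow, sq_abs, Real.sq_sqrt (len_pos hx i).le, mul_comm]
    exact Finset.single_le_sum (f := fun i => len x i * (d i - c i) ^ 2)
      (fun j _ => mul_nonneg (len_pos hx j).le (sq_nonneg _)) (Finset.mem_univ i)
  have hsum' := mul_le_mul_of_nonneg_left hsum hlam.le
  -- The case `N = 0` is split off so that `N * N ≤ 2 λ C N` can be divided by `N`.
  rcases hN0.eq_or_lt with h0 | h0
  · rw [← h0]
    have : 0 ≤ ∑ i, 2 / √(len x i) := Finset.sum_nonneg fun i _ => by positivity
    positivity
  · refine le_of_mul_le_mul_right ?_ h0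
    linarith

end

/-- Equality is only almost everywhere: `f` is arbitrary at the nodes, where `step` is zero. -/
lemma IsPiecewiseConstant.exists_step {a b : ℝ} {f : ℝ → ℝ} (hf : IsPiecewiseConstant a b f) :
    ∃ (n : ℕ) (x : Fin (n + 1) → ℝ) (d : Fin n → ℝ), StrictMono x ∧ x 0 = a ∧
      x (Fin.last n) = b ∧ f =ᵐ[vol a b] step x d := by
  obtain ⟨n, x, hx, rfl, rfl, h⟩ := hf
  choose d hd using h
  refine ⟨n, x, d, hx, rfl, rfl, ?_⟩
  filter_upwards [ae_exists_mem_piece (x := x)] with t ⟨i, hi⟩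
  rw [step_apply hx d hi, hd i t hi]

end ROF

theorem mainTheorem12 (a b : ℝ) (hab : a < b) (f : ℝ → ℝ)
    (hf : ROF.IsPiecewiseConstant a b f) :
    (∀ lam : ℝ, 0 < lam → ∃ u : ℝ → ℝ, ROF.IsMinimizer a b f lam u ∧
      ∀ v : ℝ → ℝ, ROF.IsMinimizer a b f lam v → v =ᵐ[ROF.vol a b] u) ∧
    ∀ u : ℝ → ℝ → ℝ, (∀ lam : ℝ, 0 < lam → ROF.IsMinimizer a b f lam (u lam)) →
      (∀ lam : ℝ, 0 < lam → MemLp (f - u lam) 2 (ROF.vol a b)) ∧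
      (fun lam : ℝ => (eLpNorm (f - u lam) 2 (ROF.vol a b)).toReal)
        =O[𝓝[>] (0 : ℝ)] (fun lam : ℝ => lam) := by
  obtain ⟨n, x, d, hx, rfl, rfl, hfd⟩ := hf.exists_step
  simp only [ROF.isMinimizer_congr hfd]
  refine ⟨fun lam hlam => ?_, fun u hu => ⟨fun lam hlam => ?_, ?_⟩⟩
  · obtain ⟨c, hc⟩ := ROF.exists_isMinimizer_step hx hab d hlam
    exact ⟨_, hc, fun v hv =>
      ROF.ae_eq_of_isMinimizer hlam hc hv (hc.memLp_sub hx hlam) (hv.memLp_sub hx hlam)⟩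
  · exact ((hu lam hlam).memLp_sub hx hlam).ae_eq (hfd.symm.sub (EventuallyEq.refl _ _))
  · refine IsBigO.of_bound (2 * ∑ i, 2 / √(ROF.len x i)) ?_
    filter_upwards [self_mem_nhdsWithin] with lam hlam
    replace hlam : 0 < lam := hlam
    obtain ⟨c, hc⟩ := ROF.exists_isMinimizer_step hx hab d hlam
    -- By uniqueness the given minimizer is the step minimizer, to which the explicit bound applies.
    have hae := ROF.ae_eq_of_isMinimizer hlam hc (hu lam hlam) (hc.memLp_sub hx hlam)
      ((hu lam hlam).memLp_sub hx hlam)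
    rw [Real.norm_of_nonneg ENNReal.toReal_nonneg, Real.norm_of_nonneg hlam.le,
      eLpNorm_congr_ae (hfd.sub hae), ← ROF.step_sub]
    refine le_trans (Real.le_sqrt_of_sq_le (le_of_eq ?_))
      (ROF.sqrt_sum_le_of_isMinimizer hx hlam hc)
    rw [← ENNReal.toReal_pow, ROF.eLpNorm_two_sq (ROF.memLp_step _ _),
      ENNReal.toReal_ofReal (integral_nonneg fun t => sq_nonneg _), ROF.integral_step_sq hx]
    rfl
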